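/- Let $\mathbb{K}$ be $\mathbb{R}$ or $\mathbb{C}$; all Banach spaces below are over $\mathbb{K}$, and $L_p(\mu)$, $\ell_1$ denote the spaces of $\mathbb{K}$-valued functions and sequences. A pair $(X,Y)$ of Banach spaces has the *Bishop–Phelps–Bollobás property* (BPBp) if for every $0<\varepsilon<1$ there is $\eta(\varepsilon)>0$ such that whenever $T:X\to Y$ is a bounded linear operator with $\|T\|=1$ and $x_0\in X$ satisfies $\|x_0\|=1$ and $\|Tx_0\|>1-\eta(\varepsilon)$, there exist $y_0\in X$ with $\|y_0\|=1$ and a bounded linear operator $S:X\to Y$ with $\|S\|=1$ such that $$\|Sy_0\|=1,\qquad \|y_0-x_0\|<\varepsilon,\qquad \|S-T\|<\varepsilon.$$ A Banach space $Y$ has the *Radon–Nikodým property* if for every finite measure space $(\Omega,\Sigma,m)$ and every countably additive vector measure $G:\Sigma\to Y$ of bounded variation with $G(A)=0$ whenever $m(A)=0$, there is a Bochner integrable $g:\Omega\to Y$ with $G(A)=\int_A g\,dm$ for all $A\in\Sigma$. **Corollary 2.3.** Let $\mu$ be an arbitrary (positive) measure, not necessarily $\sigma$-finite. If $Y$ is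 a Banach space with the Radon–Nikodým property and such that $(\ell_1,Y)$ has the BPBp, then $(L_1(\mu),Y)$ has the BPBp. In particular, $(L_1(\mu),L_q(\nu))$ has the BPBp for every $1<q<\infty$ and every measure $\nu$. -/

import Mathlib

open MeasureTheory
open scoped ENNReal

universe u v w

/-- The pair `(X, Y)` of Banach spaces over `𝕜` has the Bishop-Phelps-Bollobás property. -/
def BishopPhelpsBollobasProperty (𝕜 : Type*) [RCLike 𝕜]
    (X : Type*) [NormedAddCommGroup X] [NormedSpace 𝕜 X]
    (Y : Type*) [NormedAddCommGroup Y] [NormedSpace 𝕜 Y] : Prop :=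
  ∀ ε : ℝ, 0 < ε → ε < 1 → ∃ η : ℝ, 0 < η ∧
    ∀ (T : X →L[𝕜] Y) (x₀ : X), ‖T‖ = 1 → ‖x₀‖ = 1 → 1 - η < ‖T x₀‖ →
      ∃ (y₀ : X) (S : X →L[𝕜] Y), ‖y₀‖ = 1 ∧ ‖S‖ = 1 ∧
        ‖S y₀‖ = 1 ∧ ‖y₀ - x₀‖ < ε ∧ ‖S - T‖ < ε

/-- The Banach space `Y` has the Radon-Nikodým property: for every finite measure space
`(Ω, m)`, every countably additive `Y`-valued measure `G` on `Ω` of bounded variation that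
vanishes on the `m`-null sets has a Bochner integrable density with respect to `m`.
The universe `u` is that of the measure spaces `Ω`. -/
def RadonNikodymProperty (Y : Type v) [NormedAddCommGroup Y] [NormedSpace ℝ Y] : Prop :=
  ∀ (Ω : Type u) [MeasurableSpace Ω] (m : Measure Ω) [IsFiniteMeasure m]
    (G : VectorMeasure Ω Y), G.variation Set.univ < ∞ →
    (∀ A : Set Ω, MeasurableSet A → m A = 0 → G A = 0) →
    ∃ g : Ω → Y, Integrable g m ∧ ∀ A : Set Ω, MeasurableSet A → G A = ∫ x in A, g x ∂m

/-! ### Norms and multiplication operators on `L¹`. -/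

section L1

variable {𝕜 : Type*} [RCLike 𝕜] {α : Type*} [MeasurableSpace α] {m m₁ m₂ : Measure α}

/-! An integrable function only sees a finite measure. For a unit vector `f₀` of `L¹(μ)`,
multiplication by `f₀` embeds `L¹(|f₀|μ)` isometrically as an L-summand of `L¹(μ)` and sends `1` to
`f₀`. So it suffices to treat the constant `1` over a probability measure `m`, and σ-finiteness
plays no role (`BishopPhelpsBollobasProperty.of_probability`).

For the first claim, the Radon–Nikodým property gives `A ↦ T 1_A` a Bochner density. Being strongly
measurable, the density is constant up to a small uniform error on each piece of a countable
partition (`RadonNikodymProperty.exists_partition`). Averaging over the pieces fixes `1`, barely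
changes `T`, and factors through `ℓ¹`, where the hypothesis applies;
`exists_attaining_of_lProjection` carries the result back.

The second claim does not pass through `ℓ¹`: any uniformly convex range works
(`BishopPhelpsBollobasProperty.L1_of_uniformConvexSpace`). If `φ` norms `T 1`, a Hahn decomposition
gives a set `K` of nearly full measure such that the averages of `T` over non-null subsets of `K`
lie in one slice of the unit ball. Such slices have small diameter, so `T` is close on `K` to a
rank-one operator that attains its norm at `1_K / m(K)`. Uniform convexity of `L^q`
(`uniformConvexSpace_Lp`) comes from integrating a pointwise inequality proved by compactness. -/

theorem L1_norm_toLp {E : Type*} [NormedAddCommGroup E] {f : α → E} (hf : MemLp f 1 m) :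
    ‖hf.toLp f‖ = ∫ x, ‖f x‖ ∂m := by
  rw [L1.norm_eq_integral_norm]
  exact integral_congr_ae (hf.coeFn_toLp.mono fun x hx => by simp only [hx])

/-- A continuous linear map on `L¹` is bounded by its values on indicators. -/
theorem L1_norm_apply_le_of_indicator {Y : Type*} [NormedAddCommGroup Y] [NormedSpace 𝕜 Y]
    (V : Lp 𝕜 1 m →L[𝕜] Y) {c : ℝ}
    (h : ∀ (A : Set α) (hA : MeasurableSet A) (hm : m A ≠ ∞),
      ‖V (indicatorConstLp 1 hA hm (1 : 𝕜))‖ ≤ c * m.real A) (f : Lp 𝕜 1 m) :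
    ‖V f‖ ≤ c * ‖f‖ := by
  induction f using Lp.induction ENNReal.one_ne_top with
  | indicatorConst a hs hμs =>
    rename_i s
    rw [Lp.simpleFunc.coe_indicatorConst]
    have : indicatorConstLp 1 hs hμs.ne a = a • indicatorConstLp 1 hs hμs.ne (1 : 𝕜) := by
      rw [indicatorConstLp, indicatorConstLp, ← MemLp.toLp_const_smul]
      congr 1
      ext x
      by_cases hx : x ∈ s <;> simp [Set.indicator, hx]
    rw [this, map_smul, norm_smul, norm_smul, norm_indicatorConstLp (by simp) (by simp)]
    have := mul_le_mul_of_nonneg_left (h _ hs hμs.ne) (norm_nonneg a)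
    simp only [norm_one, one_mul, ENNReal.toReal_one, div_one, Real.rpow_one]
    linarith
  | add hf hg hd h₁ h₂ =>
    rename_i f g
    have : ‖hf.toLp f + hg.toLp g‖ = ‖hf.toLp f‖ + ‖hg.toLp g‖ := by
      rw [← MemLp.toLp_add, L1_norm_toLp, L1_norm_toLp, L1_norm_toLp,
        ← integral_add (memLp_one_iff_integrable.1 hf).norm (memLp_one_iff_integrable.1 hg).norm]
      congr 1
      ext x
      by_cases hx : f x = 0
      · simp [hx]
      · have : g x = 0 := by
          by_contra hgx
          exact Set.disjoint_left.1 hd (Function.mem_support.2 hx) hgx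
        simp [this]
    rw [this, map_add, mul_add]
    exact (norm_add_le _ _).trans (add_le_add h₁ h₂)
  | isClosed =>
    exact isClosed_le (by fun_prop) (by fun_prop)

/-- Multiplication by a weight as a continuous linear map between `L¹` spaces. -/
theorem exists_L1_mul {w : α → 𝕜} (hw : Measurable w)
    (hle : ∀ f : α → ℝ≥0∞, Measurable f → ∫⁻ x, ‖w x‖ₑ * f x ∂m₂ ≤ ∫⁻ x, f x ∂m₁) :
    ∃ M : Lp 𝕜 1 m₁ →L[𝕜] Lp 𝕜 1 m₂, (∀ f, M f =ᵐ[m₂] fun x => w x * f x) ∧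
      ∀ f g : α → 𝕜, f =ᵐ[m₁] g → (fun x => w x * f x) =ᵐ[m₂] fun x => w x * g x := by
  have hae : ∀ f g : α → 𝕜, f =ᵐ[m₁] g →
      (fun x => w x * f x) =ᵐ[m₂] fun x => w x * g x := by
    intro f g hfg
    have h0 : m₁ {x | f x ≠ g x} = 0 := hfg
    obtain ⟨s, hs, hsm, hs0⟩ := exists_measurable_superset_of_null h0
    -- Testing on a null set shows that `w` vanishes `m₂`-a.e. there, so the product does not depend
    -- on the representative.
    have h1 := hle (s.indicator 1) (measurable_one.indicator hsm)
    have hms : Measurable fun x => ‖w x‖ₑ * s.indicator (1 : α → ℝ≥0∞) x :=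
      hw.enorm.mul (measurable_one.indicator hsm)
    rw [lintegral_indicator_one hsm, hs0, nonpos_iff_eq_zero, lintegral_eq_zero_iff hms] at h1
    filter_upwards [h1] with x hx
    by_cases hxs : x ∈ s
    · have : w x = 0 := by simpa [hxs] using hx
      simp [this]
    · have : f x = g x := by
        by_contra hne
        exact hxs (hs hne)
      rw [this]
  have hint : ∀ f : Lp 𝕜 1 m₁, ∫⁻ x, ‖w x * f x‖ₑ ∂m₂ ≤ ENNReal.ofReal ‖f‖ := by
    intro f
    simp only [enorm_mul]
    rw [L1.ofReal_norm_eq_lintegral]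
    exact hle _ (L1.measurable_coeFn f).enorm
  have hI : ∀ f : Lp 𝕜 1 m₁, Integrable (fun x => w x * f x) m₂ := fun f =>
    ⟨(hw.mul (L1.measurable_coeFn f)).aestronglyMeasurable,
      (hint f).trans_lt ENNReal.ofReal_lt_top⟩
  refine ⟨LinearMap.mkContinuous
    { toFun := fun f => (hI f).toL1 _
      map_add' := fun f g => ?_
      map_smul' := fun c f => ?_ } 1 fun f => ?_, fun f => ?_, hae⟩
  · rw [← Integrable.toL1_add, Integrable.toL1_eq_toL1_iff]
    refine (hae _ _ (Lp.coeFn_add f g)).trans (.of_forall fun x => ?_)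
    simp [mul_add]
  · rw [RingHom.id_apply, ← Integrable.toL1_smul, Integrable.toL1_eq_toL1_iff]
    refine (hae _ _ (Lp.coeFn_smul c f)).trans (.of_forall fun x => ?_)
    simp [mul_left_comm]
  · rw [one_mul]
    change ‖(hI f).toL1 _‖ ≤ _
    rw [Integrable.norm_toL1_eq_lintegral_enorm]
    exact ENNReal.toReal_le_of_le_ofReal (norm_nonneg _) (hint f)
  · exact (hI f).coeFn_toL1

end L1

/-! ### Reduction to the constant function over a probability measure. -/

section Reduction

variable {𝕜 : Type*} [RCLike 𝕜]

/-- Transfer of an approximation from an `L`-summand `X'` of `X` to `X`. -/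
theorem exists_attaining_of_lSummand {X X' Y : Type*}
    [NormedAddCommGroup X] [NormedSpace 𝕜 X] [NormedAddCommGroup X'] [NormedSpace 𝕜 X']
    [NormedAddCommGroup Y] [NormedSpace 𝕜 Y]
    (M : X' →L[𝕜] X) (N : X →L[𝕜] X') (R : X →L[𝕜] X)
    (hNR : ∀ x, ‖N x‖ + ‖R x‖ ≤ ‖x‖) (hM : ∀ x, ‖M x‖ ≤ ‖x‖) (hNM : ∀ x, N (M x) = x)
    (hdec : ∀ x, M (N x) + R x = x) {T : X →L[𝕜] Y} (hT : ‖T‖ = 1) {x₀ : X} {x₁ : X'}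
    (hx : M x₁ = x₀) {ε : ℝ} {y : X'} {S : X' →L[𝕜] Y}
    (hy : ‖y‖ = 1) (hS : ‖S‖ ≤ 1) (hSy : ‖S y‖ = 1) (hyx : ‖y - x₁‖ < ε)
    (hST : ‖S - T.comp M‖ < ε) :
    ∃ (y₀ : X) (S' : X →L[𝕜] Y), ‖y₀‖ = 1 ∧ ‖S'‖ = 1 ∧
        ‖S' y₀‖ = 1 ∧ ‖y₀ - x₀‖ < ε ∧ ‖S' - T‖ < ε := by
  have hMn : ∀ x, ‖M x‖ = ‖x‖ := fun x => le_antisymm (hM x) (by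
    have := hNR (M x)
    rw [hNM] at this
    linarith [norm_nonneg (R (M x))])
  have hRM : ∀ x, R (M x) = 0 := fun x => by
    have := hdec (M x)
    rw [hNM] at this
    simpa using this
  have hN1 : ∀ x, ‖N x‖ ≤ ‖x‖ := fun x => by linarith [hNR x, norm_nonneg (R x)]
  -- Keeping `T` on the complementary summand makes `S' - T` live on the range of `M` only.
  let S' : X →L[𝕜] Y := S.comp N + T.comp R
  have hS'y : S' (M y) = S y := by simp [S', hNM, hRM]
  have hS'1 : ‖S'‖ ≤ 1 := ContinuousLinearMap.opNorm_le_bound _ zero_le_one fun x => by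
    have h1 : ‖S (N x)‖ ≤ 1 * ‖N x‖ := S.le_of_opNorm_le hS _
    have h2 : ‖T (R x)‖ ≤ 1 * ‖R x‖ := T.le_of_opNorm_le hT.le _
    have := norm_add_le (S (N x)) (T (R x))
    change ‖S (N x) + T (R x)‖ ≤ _
    linarith [hNR x]
  refine ⟨M y, S', by rw [hMn, hy], le_antisymm hS'1 ?_, by rw [hS'y, hSy], ?_, ?_⟩
  · have := S'.le_opNorm (M y)
    rwa [hS'y, hSy, hMn, hy, mul_one] at this
  · rwa [← hx, ← map_sub, hMn]
  · refine lt_of_le_of_lt (ContinuousLinearMap.opNorm_le_bound _ (norm_nonneg _) fun x => ?_) hST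
    have : (S' - T) x = (S - T.comp M) (N x) := by
      have h := congrArg T (hdec x)
      simp only [map_add] at h
      simp [S', ← h]
    rw [this]
    exact ((S - T.comp M).le_opNorm _).trans (by gcongr; exact hN1 x)

/-- To prove the property for `L¹(μ)` it is enough to consider the constant function `1` in the
`L¹` spaces of probability measures. -/
theorem BishopPhelpsBollobasProperty.of_probability {α : Type u} [MeasurableSpace α]
    (μ : Measure α) {Y : Type*} [NormedAddCommGroup Y] [NormedSpace 𝕜 Y]
    (H : ∀ ε : ℝ, 0 < ε → ε < 1 → ∃ η : ℝ, 0 < η ∧ ∀ (m : Measure α) [IsProbabilityMeasure m]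
      (T : Lp 𝕜 1 m →L[𝕜] Y), ‖T‖ ≤ 1 →
      1 - η < ‖T (indicatorConstLp 1 MeasurableSet.univ (measure_ne_top m _) (1 : 𝕜))‖ →
      ∃ (y : Lp 𝕜 1 m) (S : Lp 𝕜 1 m →L[𝕜] Y), ‖y‖ = 1 ∧ ‖S‖ ≤ 1 ∧ ‖S y‖ = 1 ∧
        ‖y - indicatorConstLp 1 MeasurableSet.univ (measure_ne_top m _) (1 : 𝕜)‖ < ε ∧
        ‖S - T‖ < ε) :
    BishopPhelpsBollobasProperty 𝕜 (Lp 𝕜 1 μ) Y := by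
  intro ε hε hε1
  obtain ⟨η, hη, H⟩ := H ε hε hε1
  refine ⟨η, hη, fun T f₀ hT hf₀ hTf => ?_⟩
  have hfm : Measurable f₀ := L1.measurable_coeFn f₀
  let m : Measure α := μ.withDensity fun x => ‖f₀ x‖ₑ
  have hm : IsProbabilityMeasure m := ⟨by
    rw [withDensity_apply _ MeasurableSet.univ, setLIntegral_univ,
      ← L1.ofReal_norm_eq_lintegral, hf₀, ENNReal.ofReal_one]⟩
  have hlm : ∀ f : α → ℝ≥0∞, Measurable f → ∫⁻ x, f x ∂m = ∫⁻ x, ‖f₀ x‖ₑ * f x ∂μ :=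
    fun f hf => lintegral_withDensity_eq_lintegral_mul _ hfm.enorm hf
  obtain ⟨M, hM, hMae⟩ := exists_L1_mul (m₁ := m) (m₂ := μ) hfm fun f hf => (hlm f hf).ge
  -- The convention `0⁻¹ = 0` makes `N` discard exactly the part on the zero set of `f₀`, which `R`
  -- below retains.
  obtain ⟨N, hN, hNae⟩ := exists_L1_mul (m₁ := μ) (m₂ := m) (w := fun x => (f₀ x)⁻¹) hfm.inv
    fun f hf => by
      have hms : Measurable fun x => ‖(f₀ x)⁻¹‖ₑ * f x := hfm.inv.enorm.mul hf
      rw [hlm _ hms]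
      refine lintegral_mono fun x => ?_
      rw [← mul_assoc, ← enorm_mul]
      by_cases hx : f₀ x = 0 <;> simp [hx]
  have hE : MeasurableSet {x | f₀ x = 0} := hfm (measurableSet_singleton 0)
  let χ : α → 𝕜 := Set.indicator {x | f₀ x = 0} 1
  have hχ : Measurable χ := measurable_one.indicator hE
  obtain ⟨R, hR, -⟩ := exists_L1_mul (m₁ := μ) (m₂ := μ) hχ fun f hf =>
      lintegral_mono fun x => by
      by_cases hx : f₀ x = 0 <;> simp [χ, hx]
  have hnM : ∀ x, ‖M x‖ = ‖x‖ := fun x => by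
    rw [L1.norm_def, L1.norm_def, hlm _ (L1.measurable_coeFn x).enorm]
    congr 1
    exact lintegral_congr_ae ((hM x).mono fun a ha => by simp [ha, enorm_mul])
  have hne : ∀ᵐ x ∂m, f₀ x ≠ 0 := by
    rw [ae_withDensity_iff hfm.enorm]
    exact .of_forall fun x hx => by simpa using hx
  let one : Lp 𝕜 1 m := indicatorConstLp 1 MeasurableSet.univ (measure_ne_top m _) (1 : 𝕜)
  have hM1 : M one = f₀ := by
    refine Lp.ext ((hM _).trans ((hMae _ _ indicatorConstLp_coeFn).trans (.of_forall fun x => ?_)))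
    simp
  obtain ⟨y, S, hy, hS, hSy, hy1, hST⟩ := H m (T.comp M)
    (ContinuousLinearMap.opNorm_le_bound _ zero_le_one fun x => by
      simpa [hnM] using T.le_of_opNorm_le hT.le (M x)) (by
      change 1 - η < ‖T (M one)‖
      rwa [hM1])
  refine exists_attaining_of_lSummand M N R (fun x => ?_) (fun x => (hnM x).le) (fun x => ?_)
    (fun x => ?_) hT hM1 hy hS hSy hy1 hST
  · have hms : Measurable fun a => ‖(f₀ a)⁻¹ * x a‖ₑ :=
        (hfm.inv.mul (L1.measurable_coeFn x)).enorm
    rw [L1.norm_def, L1.norm_def, L1.norm_def, ← ENNReal.toReal_add]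
    · refine ENNReal.toReal_mono ?_ ?_
      · rw [← L1.ofReal_norm_eq_lintegral]; simp
      · rw [lintegral_congr_ae ((hN x).mono fun a ha => by rw [ha]),
          lintegral_congr_ae ((hR x).mono fun a ha => by rw [ha]),
          hlm _ hms, ← lintegral_add_left]
        · refine lintegral_mono fun a => ?_
          by_cases ha : f₀ a = 0
          · simp [ha, χ]
          · simp [χ, ha, ← enorm_mul]
        · exact hfm.enorm.mul hms
    · rw [← L1.ofReal_norm_eq_lintegral]; simp
    · rw [← L1.ofReal_norm_eq_lintegral]; simp
  · refine Lp.ext ((hN _).trans ((hNae _ _ (hM x)).trans (hne.mono fun a ha => ?_)))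
    simp [ha]
  · refine Lp.ext ((Lp.coeFn_add _ _).trans ?_)
    filter_upwards [hM (N x), hMae _ _ (hN x), hR x] with a h1 h2 h3
    rw [Pi.add_apply, h1, h2, h3]
    by_cases ha : f₀ a = 0 <;> simp [ha, χ]

end Reduction

/-! ### Indicators as an `L¹`-valued measure. -/

section IndicatorMeasure

open Filter Topology

variable (𝕜 : Type*) [RCLike 𝕜] {α : Type*} [MeasurableSpace α] (m : Measure α) [IsFiniteMeasure m]

open scoped Classical in
/-- The `L¹(m)`-valued measure sending a measurable set to its indicator function. -/
noncomputable def indicatorVectorMeasure : VectorMeasure α (Lp 𝕜 1 m) where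
  measureOf' A := if hA : MeasurableSet A then indicatorConstLp 1 hA (measure_ne_top m A) (1 : 𝕜)
    else 0
  empty' := by
    rw [dif_pos MeasurableSet.empty]
    exact indicatorConstLp_empty
  not_measurable' A hA := dif_neg hA
  m_iUnion' f hf hd := by
    have hU : MeasurableSet (⋃ i, f i) := MeasurableSet.iUnion hf
    simp only [hf, hU, dif_pos]
    have hsum : ∀ s : Finset ℕ, ∑ i ∈ s, indicatorConstLp 1 (hf i) (measure_ne_top m _) (1 : 𝕜) =
        indicatorConstLp 1 (s.measurableSet_biUnion fun i _ => hf i) (measure_ne_top m _) 1 := by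
      intro s
      induction s using Finset.induction_on with
      | empty => simp
      | insert a s ha ih =>
        rw [Finset.sum_insert ha, ih, ← indicatorConstLp_disjoint_union]
        · simp only [Finset.set_biUnion_insert]
        · rw [Set.disjoint_iUnion₂_right]
          exact fun i hi => hd fun h => ha (h ▸ hi)
    rw [HasSum]
    simp only [hsum]
    -- Convergence of indicators amounts to symmetric differences of vanishing measure, so countable
    -- additivity of `m` suffices.
    refine tendsto_indicatorConstLp_set ENNReal.one_ne_top ?_
    have h1 : HasSum (fun i => m (f i)) (m (⋃ i, f i)) := by
      rw [measure_iUnion hd hf]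
      exact ENNReal.summable.hasSum
    have h2 := ENNReal.Tendsto.sub (tendsto_const_nhds (x := m (⋃ i, f i))) h1
      (Or.inl (measure_ne_top m _))
    rw [tsub_self] at h2
    refine h2.congr fun s => ?_
    have hsub : (⋃ i ∈ s, f i) ⊆ ⋃ i, f i := Set.iUnion₂_subset fun i _ => Set.subset_iUnion f i
    rw [Set.symmDiff_def, Set.sdiff_eq_empty.2 hsub, Set.empty_union, measure_sdiff hsub
      (s.measurableSet_biUnion fun i _ => hf i).nullMeasurableSet (measure_ne_top m _),
      measure_biUnion_finset (fun i _ j _ hij => hd hij) fun i _ => hf i]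

variable {𝕜 m}

theorem indicatorVectorMeasure_apply {A : Set α} (hA : MeasurableSet A) :
    indicatorVectorMeasure 𝕜 m A = indicatorConstLp 1 hA (measure_ne_top m A) (1 : 𝕜) :=
  dif_pos hA

theorem indicatorVectorMeasure_coeFn {A : Set α} (hA : MeasurableSet A) :
    indicatorVectorMeasure 𝕜 m A =ᵐ[m] A.indicator fun _ => (1 : 𝕜) := by
  rw [indicatorVectorMeasure_apply hA]
  exact indicatorConstLp_coeFn

theorem norm_indicatorVectorMeasure {A : Set α} (hA : MeasurableSet A) :
    ‖indicatorVectorMeasure 𝕜 m A‖ = m.real A := by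
  rw [indicatorVectorMeasure_apply hA, norm_indicatorConstLp one_ne_zero ENNReal.one_ne_top]
  simp

theorem opNorm_le_of_indicatorVectorMeasure {Y : Type*} [NormedAddCommGroup Y] [NormedSpace 𝕜 Y]
    {V : Lp 𝕜 1 m →L[𝕜] Y} {c : ℝ} (hc : 0 ≤ c)
    (h : ∀ A : Set α, MeasurableSet A → ‖V (indicatorVectorMeasure 𝕜 m A)‖ ≤ c * m.real A) :
    ‖V‖ ≤ c :=
  ContinuousLinearMap.opNorm_le_bound _ hc <| L1_norm_apply_le_of_indicator V fun A hA _ => by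
    have := h A hA
    rwa [indicatorVectorMeasure_apply hA] at this

variable (𝕜 m)

theorem exists_L1_restrict {K : Set α} (hK : MeasurableSet K) :
    ∃ Q : Lp 𝕜 1 m →L[𝕜] Lp 𝕜 1 m, ∀ A, MeasurableSet A →
      Q (indicatorVectorMeasure 𝕜 m A) = indicatorVectorMeasure 𝕜 m (A ∩ K) := by
  obtain ⟨Q, hQ, hQ'⟩ := exists_L1_mul (m₁ := m) (m₂ := m) (w := K.indicator (1 : α → 𝕜))
    (measurable_one.indicator hK) fun f _ => lintegral_mono fun x => by
      by_cases hx : x ∈ K <;> simp [hx]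
  refine ⟨Q, fun A hA => Lp.ext ((hQ _).trans ((hQ' _ _ (indicatorVectorMeasure_coeFn hA)).trans
    (.trans (.of_forall fun x => ?_) (indicatorVectorMeasure_coeFn (hA.inter hK)).symm)))⟩
  by_cases hx : x ∈ K <;> by_cases hx' : x ∈ A <;> simp [hx, hx']

theorem exists_L1_integral :
    ∃ I : Lp 𝕜 1 m →L[𝕜] 𝕜, ∀ A, MeasurableSet A →
      I (indicatorVectorMeasure 𝕜 m A) = (m.real A : 𝕜) := by
  refine ⟨L1.integralCLM' 𝕜, fun A hA => ?_⟩
  have h1 := L1.integral_eq_integral (indicatorVectorMeasure 𝕜 m A)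
  rw [integral_congr_ae (indicatorVectorMeasure_coeFn hA), integral_indicator hA,
    setIntegral_const] at h1
  rw [← L1.integral_eq', h1, RCLike.real_smul_eq_coe_mul, mul_one]

end IndicatorMeasure

/-! ### Uniformly convex range. -/

section UniformlyConvex

variable {𝕜 : Type*} [RCLike 𝕜] {α : Type u} [MeasurableSpace α]

/-- The signed measure `A ↦ Re φ (T 1_A) - c m(A)`, where `φ ∘ T` is a functional on `L¹(m)`. -/
theorem exists_signedMeasure_functional (m : Measure α) [IsFiniteMeasure m]
    (F : Lp 𝕜 1 m →L[𝕜] 𝕜) (c : ℝ) :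
    ∃ s : SignedMeasure α, ∀ A, MeasurableSet A →
      s A = RCLike.re (F (indicatorVectorMeasure 𝕜 m A)) - c * m.real A := by
  have hF : Continuous ((RCLike.re : 𝕜 →+ ℝ).comp (F : Lp 𝕜 1 m →+ 𝕜)) :=
    RCLike.continuous_re.comp F.continuous
  refine ⟨(indicatorVectorMeasure 𝕜 m).mapRange _ hF - c • m.toSignedMeasure, fun A hA => ?_⟩
  rw [sub_apply, smul_apply, VectorMeasure.mapRange_apply,
    Measure.toSignedMeasure_apply_measurable hA]
  rfl

/-- Two points of a slice have a sum of norm at least `2 - 2r`; uniform convexity forbids this at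
distance `ε` once `2r < δ`. -/
theorem exists_slice_diam_lt (Y : Type*) [NormedAddCommGroup Y] [NormedSpace ℝ Y]
    [NormedSpace 𝕜 Y] [UniformConvexSpace Y] {ε : ℝ} (hε : 0 < ε) :
    ∃ r : ℝ, 0 < r ∧ r < 1 ∧ ∀ φ : StrongDual 𝕜 Y, ‖φ‖ = 1 → ∀ x y : Y, ‖x‖ ≤ 1 → ‖y‖ ≤ 1 →
      1 - r ≤ RCLike.re (φ x) → 1 - r ≤ RCLike.re (φ y) → ‖x - y‖ < ε := by
  obtain ⟨δ, hδ, h⟩ := exists_forall_closed_ball_dist_add_le_two_sub Y hε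
  refine ⟨min (δ / 4) (1 / 2), by positivity, (min_le_right _ _).trans_lt (by norm_num),
    fun φ hφ x y hx hy hφx hφy => ?_⟩
  by_contra! hxy
  have h1 := h hx hy hxy
  have h2 : ‖φ (x + y)‖ ≤ 1 * ‖x + y‖ := φ.le_of_opNorm_le hφ.le _
  have h3 := RCLike.re_le_norm (φ (x + y))
  rw [map_add, map_add] at h3
  have := min_le_left (δ / 4) (1 / 2 : ℝ)
  rw [map_add] at h2
  linarith

theorem BishopPhelpsBollobasProperty.L1_of_uniformConvexSpace (μ : Measure α)
    (Y : Type*) [NormedAddCommGroup Y] [NormedSpace ℝ Y] [NormedSpace 𝕜 Y]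
    [UniformConvexSpace Y] : BishopPhelpsBollobasProperty 𝕜 (Lp 𝕜 1 μ) Y := by
  refine .of_probability μ fun ε hε hε1 => ?_
  obtain ⟨r, hr, hr1, hslice⟩ := exists_slice_diam_lt (𝕜 := 𝕜) Y (show 0 < ε / 4 by positivity)
  -- Chosen so that `r * (1 - m(K)) < η` yields `1 - m(K) < ε / 4`.
  refine ⟨r * (ε / 4), by positivity, fun m _ T hT hT1 => ?_⟩
  have hη1 : r * (ε / 4) < 1 := by nlinarith
  rw [← indicatorVectorMeasure_apply] at hT1 ⊢
  set χ := indicatorVectorMeasure 𝕜 m with hχ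
  have hTχ : ∀ A, MeasurableSet A → ‖T (χ A)‖ ≤ m.real A := fun A hA => by
    have := T.le_of_opNorm_le hT (χ A)
    rwa [norm_indicatorVectorMeasure hA, one_mul] at this
  obtain ⟨φ, hφ, hφT⟩ := exists_dual_vector 𝕜 (T (χ Set.univ)) (by
    exact ((sub_pos.2 hη1).trans hT1).ne')
  obtain ⟨s, hs⟩ := exists_signedMeasure_functional m (φ.comp T) (1 - r)
  -- On subsets of the positive set `K`, averages of `T` lie in the slice `Re φ ≥ 1 - r`.
  obtain ⟨K, hK, hpos, hneg⟩ := s.exists_compl_positive_negative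
  have hKA : ∀ A, MeasurableSet A → A ⊆ K → (1 - r) * m.real A ≤ RCLike.re (φ (T (χ A))) := by
    intro A hA hAK
    have := VectorMeasure.subset_le_of_restrict_le_restrict 0 s hK hpos hAK
    rw [hs A hA] at this
    simpa using this
  have hKc : RCLike.re (φ (T (χ Kᶜ))) ≤ (1 - r) * m.real Kᶜ := by
    have := VectorMeasure.subset_le_of_restrict_le_restrict s 0 hK.compl hneg subset_rfl
    rw [hs _ hK.compl] at this
    simpa using this
  have hφn : ∀ z, RCLike.re (φ z) ≤ ‖z‖ := fun z =>
    (RCLike.re_le_norm _).trans (by simpa using φ.le_of_opNorm_le hφ.le z)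
  have hadd : ∀ A, MeasurableSet A → χ (A ∩ K) + χ (A ∩ Kᶜ) = χ A := fun A hA => by
    rw [← VectorMeasure.of_union _ (hA.inter hK) (hA.inter hK.compl), ← Set.inter_union_distrib_left,
      Set.union_compl_self, Set.inter_univ]
    exact Set.disjoint_left.2 fun x hx hx' => hx'.2 hx.2
  have hmadd : ∀ A, m.real (A ∩ K) + m.real (A ∩ Kᶜ) = m.real A := fun A =>
    measureReal_inter_add_sdiff hK
  have huniv : χ K + χ Kᶜ = χ Set.univ := by simpa using hadd _ MeasurableSet.univ
  have hmuniv : m.real K + m.real Kᶜ = 1 := by simpa using hmadd Set.univ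
  set a := m.real K with ha
  -- Here `1 - η < ‖T 1‖ ≤ a + (1 - r)(1 - a)`, the two terms bounding the contributions of `K` and
  -- `Kᶜ`.
  have hKlarge : 1 - a < ε / 4 := by
    have h1 : ‖T (χ Set.univ)‖ = RCLike.re (φ (T (χ K))) + RCLike.re (φ (T (χ Kᶜ))) := by
      rw [← map_add, ← map_add, ← map_add, huniv, hφT, RCLike.ofReal_re]
    have h2 := (hφn _).trans (hTχ K hK)
    have : r * (1 - a) < r * (ε / 4) := by
      have : m.real Kᶜ = 1 - a := by linarith
      rw [this] at hKc
      linarith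
    exact lt_of_mul_lt_mul_left this hr.le
  have ha0 : 0 < a := by linarith
  have ha1 : a ≤ 1 := measureReal_le_one
  have hTK : (1 - r) * a ≤ ‖T (χ K)‖ := (hKA K hK subset_rfl).trans (hφn _)
  have hTK0 : 0 < ‖T (χ K)‖ := lt_of_lt_of_le (by nlinarith) hTK
  set z : Y := ((‖T (χ K)‖ : 𝕜)⁻¹) • T (χ K) with hz
  have hz1 : ‖z‖ = 1 := by
    rw [hz, norm_smul, norm_inv, RCLike.norm_ofReal, abs_of_pos hTK0, inv_mul_cancel₀ hTK0.ne']
  have hφz : 1 - r ≤ RCLike.re (φ z) := by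
    rw [hz, map_smul, smul_eq_mul, ← RCLike.ofReal_inv, RCLike.re_ofReal_mul,
      ← div_eq_inv_mul, le_div_iff₀ hTK0]
    refine le_trans ?_ (hKA K hK subset_rfl)
    exact mul_le_mul_of_nonneg_left (hTχ K hK) (by linarith)
  have hclose : ∀ A, MeasurableSet A → A ⊆ K →
      ‖(m.real A : 𝕜) • z - T (χ A)‖ ≤ ε / 4 * m.real A := by
    intro A hA hAK
    rcases (measureReal_nonneg (μ := m) (s := A)).eq_or_lt with h0 | h0
    · have := hTχ A hA
      rw [← h0] at this ⊢
      simpa using this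
    · have hne : (m.real A : 𝕜) ≠ 0 := by exact_mod_cast h0.ne'
      have h1 : ‖z - (m.real A : 𝕜)⁻¹ • T (χ A)‖ < ε / 4 := by
        refine hslice φ hφ _ _ hz1.le ?_ hφz ?_
        · rw [norm_smul, norm_inv, RCLike.norm_ofReal, abs_of_pos h0, ← div_eq_inv_mul,
            div_le_one h0]
          exact hTχ A hA
        · rw [map_smul, smul_eq_mul, ← RCLike.ofReal_inv, RCLike.re_ofReal_mul,
            ← div_eq_inv_mul, le_div_iff₀ h0]
          exact hKA A hA hAK
      have h2 : (m.real A : 𝕜) • z - T (χ A) =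
          (m.real A : 𝕜) • (z - (m.real A : 𝕜)⁻¹ • T (χ A)) := by
        rw [smul_sub, smul_inv_smul₀ hne]
      rw [h2, norm_smul, RCLike.norm_ofReal, abs_of_pos h0, mul_comm]
      exact mul_le_mul_of_nonneg_right h1.le h0.le
  obtain ⟨Q, hQ⟩ := exists_L1_restrict 𝕜 m hK
  obtain ⟨I, hI⟩ := exists_L1_integral 𝕜 m
  -- On `K` this is `f ↦ (∫_K f) • z`; off `K` it is `T`.
  let S : Lp 𝕜 1 m →L[𝕜] Y := T - T.comp Q + (I.comp Q).smulRight z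
  have hS : ∀ A, MeasurableSet A →
      S (χ A) = T (χ A) - T (χ (A ∩ K)) + (m.real (A ∩ K) : 𝕜) • z := fun A hA => by
    change T (χ A) - T (Q (χ A)) + I (Q (χ A)) • z = _
    rw [hχ, hQ A hA, hI _ (hA.inter hK)]
  have hχK : ‖χ K‖ = a := norm_indicatorVectorMeasure hK
  have hχKc : ‖χ Kᶜ‖ = 1 - a := by
    rw [norm_indicatorVectorMeasure hK.compl]; linarith
  have ha𝕜 : (a : 𝕜) ≠ 0 := by exact_mod_cast ha0.ne'
  refine ⟨(a : 𝕜)⁻¹ • χ K, S, ?_, ?_, ?_, ?_, ?_⟩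
  · rw [norm_smul, hχK, norm_inv, RCLike.norm_ofReal, abs_of_pos ha0, inv_mul_cancel₀ ha0.ne']
  · refine opNorm_le_of_indicatorVectorMeasure zero_le_one fun A hA => ?_
    rw [hS A hA]
    have h1 : T (χ A) - T (χ (A ∩ K)) = T (χ (A ∩ Kᶜ)) := by
      rw [← hadd A hA, map_add]; abel
    rw [h1, one_mul, ← hmadd A, add_comm (m.real _)]
    refine (norm_add_le _ _).trans (add_le_add (hTχ _ (hA.inter hK.compl)) ?_)
    rw [norm_smul, hz1, mul_one, RCLike.norm_ofReal, abs_of_nonneg measureReal_nonneg]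
  · rw [map_smul, hS K hK, Set.inter_self, sub_self, zero_add, ← ha, inv_smul_smul₀ ha𝕜, hz1]
  · have h1 : (a : 𝕜)⁻¹ • χ K - χ Set.univ = ((a⁻¹ - 1 : ℝ) : 𝕜) • χ K - χ Kᶜ := by
      rw [← huniv]
      push_cast
      rw [sub_smul, one_smul]
      abel
    rw [h1]
    refine (norm_sub_le _ _).trans_lt ?_
    rw [norm_smul, hχK, hχKc, RCLike.norm_ofReal,
      abs_of_nonneg (sub_nonneg.2 ((one_le_inv₀ ha0).2 ha1)), sub_mul, inv_mul_cancel₀ ha0.ne']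
    linarith
  · refine (opNorm_le_of_indicatorVectorMeasure (c := ε / 4) (by positivity)
      fun A hA => ?_).trans_lt (by linarith)
    rw [sub_apply, hS A hA]
    have h1 : T (χ A) - T (χ (A ∩ K)) + (m.real (A ∩ K) : 𝕜) • z - T (χ A) =
        (m.real (A ∩ K) : 𝕜) • z - T (χ (A ∩ K)) := by abel
    rw [h1]
    refine (hclose _ (hA.inter hK) Set.inter_subset_right).trans ?_
    exact mul_le_mul_of_nonneg_left (measureReal_mono Set.inter_subset_left) (by positivity)

end UniformlyConvex

/-! ### Operators on `ℓ¹` and transfer along an L-projection. -/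

section EllOne

variable {𝕜 : Type*} [RCLike 𝕜]

theorem lp_one_hasSum_norm (z : lp (fun _ : ℕ => 𝕜) 1) : HasSum (fun k => ‖z k‖) ‖z‖ := by
  simpa using lp.hasSum_norm (p := 1) (by simp) z

/-- A bounded sequence in a Banach space induces an operator on `ℓ¹`. -/
theorem exists_lp_one_lift {X : Type*} [NormedAddCommGroup X] [NormedSpace 𝕜 X] [CompleteSpace X]
    {u : ℕ → X} (hu : ∀ k, ‖u k‖ ≤ 1) :
    ∃ J : lp (fun _ : ℕ => 𝕜) 1 →L[𝕜] X,
      (∀ z, HasSum (fun k => z k • u k) (J z)) ∧ ∀ z, ‖J z‖ ≤ ‖z‖ := by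
  have hle : ∀ (z : lp (fun _ : ℕ => 𝕜) 1) k, ‖z k • u k‖ ≤ ‖z k‖ := fun z k => by
    rw [norm_smul]
    exact mul_le_of_le_one_right (norm_nonneg _) (hu k)
  have hs : ∀ z : lp (fun _ : ℕ => 𝕜) 1, Summable fun k => z k • u k := fun z =>
    .of_norm_bounded (lp_one_hasSum_norm z).summable (hle z)
  have hn : ∀ z : lp (fun _ : ℕ => 𝕜) 1, ‖∑' k, z k • u k‖ ≤ ‖z‖ := fun z =>
    tsum_of_norm_bounded (lp_one_hasSum_norm z) (hle z)
  refine ⟨LinearMap.mkContinuous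
    { toFun := fun z => ∑' k, z k • u k
      map_add' := fun z w => ?_
      map_smul' := fun c z => ?_ } 1 fun z => by simpa using hn z,
    fun z => (hs z).hasSum, hn⟩
  · rw [← (hs z).tsum_add (hs w)]
    simp [add_smul]
  · rw [RingHom.id_apply, ← (hs z).tsum_const_smul]
    simp [mul_smul]

/-- Transfer of an approximation from `Z` to `X` along maps `J : Z → X` and `P : X → Z`
such that `P ∘ J` is an `L`-projection on whose range `J` is isometric. -/
theorem exists_attaining_of_lProjection {X Y Z : Type*}
    [NormedAddCommGroup X] [NormedSpace 𝕜 X] [NormedAddCommGroup Y] [NormedSpace 𝕜 Y]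
    [NormedAddCommGroup Z] [NormedSpace 𝕜 Z] {J : Z →L[𝕜] X} {P : X →L[𝕜] Z}
    (hP : ∀ x, ‖P x‖ ≤ ‖x‖) (hJ : ∀ z, ‖J z‖ ≤ ‖P (J z)‖)
    (hPJ : ∀ z, ‖z - P (J z)‖ + ‖P (J z)‖ ≤ ‖z‖)
    {x₀ : X} (hx₀ : ‖x₀‖ = 1) (hJP : J (P x₀) = x₀) {ε η : ℝ} (hε1 : ε < 1)
    (h : ∀ (T : Z →L[𝕜] Y) (x₀ : Z), ‖T‖ = 1 → ‖x₀‖ = 1 → 1 - η < ‖T x₀‖ →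
      ∃ (y₀ : Z) (S : Z →L[𝕜] Y), ‖y₀‖ = 1 ∧ ‖S‖ = 1 ∧
        ‖S y₀‖ = 1 ∧ ‖y₀ - x₀‖ < ε ∧ ‖S - T‖ < ε)
    {T : X →L[𝕜] Y} (hT : ‖T‖ ≤ 1) (hTη : 1 - η < ‖T x₀‖) (hTε : 1 - ε < ‖T x₀‖)
    (hTJP : ‖T - T.comp (J.comp P)‖ ≤ ε) :
    ∃ (y : X) (S : X →L[𝕜] Y), ‖y‖ = 1 ∧ ‖S‖ ≤ 1 ∧ ‖S y‖ = 1 ∧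
        ‖y - x₀‖ < 2 * ε ∧ ‖S - T‖ < 3 * ε := by
  have hPJ1 : ∀ z, ‖P (J z)‖ ≤ ‖z‖ := fun z => by linarith [hPJ z, norm_nonneg (z - P (J z))]
  have hJ1 : ∀ z, ‖J z‖ ≤ ‖z‖ := fun z => (hJ z).trans (hPJ1 z)
  have hz₀ : ‖P x₀‖ = 1 := le_antisymm (hx₀ ▸ hP x₀) (by
    rw [← hx₀]
    exact (congrArg norm hJP).symm.le.trans (hJ1 _))
  -- The hypothesis `h` requires norm one, so `T ∘ J` is rescaled; as `b > 1 - ε`, this costs less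
  -- than `ε`.
  set b := ‖T.comp J‖ with hb
  have hb1 : b ≤ 1 := ContinuousLinearMap.opNorm_le_bound _ zero_le_one fun z =>
    (T.le_of_opNorm_le hT _).trans (by simpa using hJ1 z)
  have hTb : ‖T x₀‖ ≤ b := by
    have := (T.comp J).le_opNorm (P x₀)
    rwa [hz₀, mul_one, ContinuousLinearMap.comp_apply, hJP] at this
  have hb0 : 0 < b := by linarith
  have hb𝕜 : ‖(b : 𝕜)⁻¹‖ = b⁻¹ := by
    rw [norm_inv, RCLike.norm_ofReal, abs_of_pos hb0]
  obtain ⟨z, S, hz, hS, hSz, hzz, hST⟩ := h ((b : 𝕜)⁻¹ • T.comp J) (P x₀)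
    (by rw [norm_smul, hb𝕜, ← hb, inv_mul_cancel₀ hb0.ne']) hz₀ (by
      rw [smul_apply, norm_smul, hb𝕜, ContinuousLinearMap.comp_apply, hJP]
      exact hTη.trans_le (le_mul_of_one_le_left (norm_nonneg _) ((one_le_inv₀ hb0).2 hb1)))
  have hST' : ‖S - T.comp J‖ < 2 * ε := by
    have h1 : S - T.comp J = (S - (b : 𝕜)⁻¹ • T.comp J) + ((b⁻¹ - 1 : ℝ) : 𝕜) • T.comp J := by
      push_cast
      rw [sub_smul, one_smul]
      abel
    have h2 : ‖((b⁻¹ - 1 : ℝ) : 𝕜) • T.comp J‖ = 1 - b := by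
      rw [norm_smul, RCLike.norm_ofReal, ← hb,
        abs_of_nonneg (sub_nonneg.2 ((one_le_inv₀ hb0).2 hb1)), sub_mul, inv_mul_cancel₀ hb0.ne',
        one_mul]
    rw [h1]
    refine (norm_add_le _ _).trans_lt ?_
    rw [h2]
    linarith
  have hS1 : ∀ w, ‖S w‖ ≤ ‖w‖ := fun w => by simpa using S.le_of_opNorm_le hS.le w
  -- An L-decomposition of a norm-attaining vector forces `S` to preserve the norm of each
  -- component.
  have hSPJ : ‖S (P (J z))‖ = ‖P (J z)‖ := by
    refine le_antisymm (hS1 _) ?_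
    have h1 : S z = S (z - P (J z)) + S (P (J z)) := by rw [← map_add, sub_add_cancel]
    have h2 := norm_add_le (S (z - P (J z))) (S (P (J z)))
    rw [← h1, hSz] at h2
    linarith [hPJ z, hS1 (z - P (J z))]
  have hJz : ‖P (J z)‖ = ‖J z‖ := le_antisymm (hP _) (hJ z)
  have hJx : ‖J z - x₀‖ < ε := by
    rw [← hJP, ← map_sub]
    exact (hJ1 _).trans_lt hzz
  set t := ‖J z‖ with ht
  have ht1 : t ≤ 1 := hz ▸ hJ1 z
  have htε : 1 - ε < t := by
    have := norm_sub_norm_le x₀ (J z)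
    rw [norm_sub_rev, hx₀] at this
    linarith
  have ht0 : 0 < t := by linarith
  have ht𝕜 : ‖(t : 𝕜)⁻¹‖ = t⁻¹ := by
    rw [norm_inv, RCLike.norm_ofReal, abs_of_pos ht0]
  refine ⟨(t : 𝕜)⁻¹ • J z, S.comp P, ?_, ?_, ?_, ?_, ?_⟩
  · rw [norm_smul, ht𝕜, inv_mul_cancel₀ ht0.ne']
  · exact ContinuousLinearMap.opNorm_le_bound _ zero_le_one fun x => by
      rw [one_mul]
      exact (hS1 _).trans (hP x)
  · rw [map_smul, norm_smul, ht𝕜, ContinuousLinearMap.comp_apply, hSPJ, hJz,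
      inv_mul_cancel₀ ht0.ne']
  · have h1 : (t : 𝕜)⁻¹ • J z - x₀ = ((t⁻¹ - 1 : ℝ) : 𝕜) • J z + (J z - x₀) := by
      push_cast
      rw [sub_smul, one_smul]
      abel
    have h2 : ‖((t⁻¹ - 1 : ℝ) : 𝕜) • J z‖ = 1 - t := by
      rw [norm_smul, RCLike.norm_ofReal, ← ht,
        abs_of_nonneg (sub_nonneg.2 ((one_le_inv₀ ht0).2 ht1)), sub_mul, inv_mul_cancel₀ ht0.ne',
        one_mul]
    rw [h1]
    refine (norm_add_le _ _).trans_lt ?_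
    rw [h2]
    linarith
  · have h1 : S.comp P - T = (S - T.comp J).comp P - (T - T.comp (J.comp P)) := by
      ext x
      simp
    have h2 : ‖(S - T.comp J).comp P‖ ≤ ‖S - T.comp J‖ :=
      ContinuousLinearMap.opNorm_le_bound _ (norm_nonneg _) fun x =>
        ((S - T.comp J).le_opNorm _).trans (by gcongr; exact hP x)
    rw [h1]
    refine (norm_sub_le _ _).trans_lt ?_
    linarith

end EllOne

/-! ### Partitions from the Radon–Nikodým property. -/

section RadonNikodym

variable {𝕜 : Type*} [RCLike 𝕜] {α : Type u} [MeasurableSpace α]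

/-- A strongly measurable function is uniformly close to a countably valued one. -/
theorem MeasureTheory.StronglyMeasurable.exists_partition_dist_le {Y : Type*}
    [PseudoMetricSpace Y] [Nonempty α] {g : α → Y} (hg : StronglyMeasurable g) {δ : ℝ}
    (hδ : 0 < δ) :
    ∃ (A : ℕ → Set α) (y : ℕ → Y), (∀ k, MeasurableSet (A k)) ∧
      Pairwise (Function.onFun Disjoint A) ∧ (⋃ k, A k) = Set.univ ∧
      ∀ k, ∀ x ∈ A k, dist (g x) (y k) ≤ δ := by
  borelize Y
  obtain ⟨c, hc, hgc⟩ := hg.isSeparable_range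
  have hcne : c.Nonempty := by
    rw [← closure_nonempty_iff]
    exact (Set.range_nonempty g).mono hgc
  obtain ⟨y, rfl⟩ := hc.exists_eq_range hcne
  have hB : ∀ k, MeasurableSet (g ⁻¹' Metric.closedBall (y k) δ) := fun k =>
    hg.measurable Metric.isClosed_closedBall.measurableSet
  refine ⟨disjointed fun k => g ⁻¹' Metric.closedBall (y k) δ, y,
    fun k => MeasurableSet.disjointed hB k, disjoint_disjointed _, ?_,
    fun k x hx => disjointed_subset _ k hx⟩
  rw [iUnion_disjointed, Set.eq_univ_iff_forall]
  intro x
  obtain ⟨_, ⟨k, rfl⟩, hk⟩ := Metric.mem_closure_iff.1 (hgc (Set.mem_range_self x)) δ hδ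
  exact Set.mem_iUnion.2 ⟨k, hk.le⟩

/-- The measure `B ↦ T 1_B` is dominated in norm by `m`, hence has bounded variation and a density.
Integrating over `B` the uniform closeness of the density to `y k` gives the estimate. -/
theorem RadonNikodymProperty.exists_partition {Y : Type v} [NormedAddCommGroup Y]
    [NormedSpace ℝ Y] [NormedSpace 𝕜 Y] [IsScalarTower ℝ 𝕜 Y] [CompleteSpace Y]
    (hY : RadonNikodymProperty.{u, v} Y) (m : Measure α) [IsProbabilityMeasure m]
    {T : Lp 𝕜 1 m →L[𝕜] Y} (hT : ‖T‖ ≤ 1) {δ : ℝ} (hδ : 0 < δ) :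
    ∃ (A : ℕ → Set α) (y : ℕ → Y), (∀ k, MeasurableSet (A k)) ∧
      Pairwise (Function.onFun Disjoint A) ∧ (⋃ k, A k) = Set.univ ∧
      ∀ k B, MeasurableSet B → B ⊆ A k →
        ‖T (indicatorVectorMeasure 𝕜 m B) - (m.real B : 𝕜) • y k‖ ≤ δ * m.real B := by
  have := m.nonempty_of_neZero
  let G : VectorMeasure α Y := (indicatorVectorMeasure 𝕜 m).mapRange (T : Lp 𝕜 1 m →+ Y)
    T.continuous
  have hG : ∀ B, G B = T (indicatorVectorMeasure 𝕜 m B) := fun B => rfl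
  have hGn : ∀ B, MeasurableSet B → ‖G B‖ ≤ m.real B := fun B hB => by
    have := T.le_of_opNorm_le hT (indicatorVectorMeasure 𝕜 m B)
    rwa [norm_indicatorVectorMeasure hB, one_mul] at this
  obtain ⟨g, hg, hGg⟩ := hY α m G
    (lt_of_le_of_lt (VectorMeasure.variation_le_of_forall_enorm_le (m := m) (fun B hB => by
      rw [← ofReal_norm, ← ofReal_measureReal]
      exact ENNReal.ofReal_le_ofReal (hGn B hB)) _) (measure_lt_top m _))
    (fun B hB hB0 => by
      have := hGn B hB
      rwa [measureReal_def, hB0, ENNReal.toReal_zero, norm_le_zero_iff] at this)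
  obtain ⟨A, y, hA, hd, hU, hAy⟩ := hg.1.stronglyMeasurable_mk.exists_partition_dist_le hδ
  refine ⟨A, y, hA, hd, hU, fun k B hB hBA => ?_⟩
  rw [← hG, hGg B hB, ← RCLike.real_smul_eq_coe_smul, ← setIntegral_const,
    ← integral_sub hg.integrableOn (integrable_const _)]
  refine norm_setIntegral_le_of_norm_le_const_ae' (measure_lt_top m B) ?_
  filter_upwards [hg.1.ae_eq_mk] with x hx hxB
  rw [hx, ← dist_eq_norm]
  exact hAy k x (hBA hxB)

end RadonNikodym

/-! ### From `ℓ¹` to `L¹`. -/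

section RadonNikodym

variable {𝕜 : Type*} [RCLike 𝕜] {α : Type u} [MeasurableSpace α]

/-- The integrals over the pieces of a partition, as an operator from `L¹(m)` to `ℓ¹`. -/
theorem exists_L1_to_lp_one (m : Measure α) [IsFiniteMeasure m] {A : ℕ → Set α}
    (hA : ∀ k, MeasurableSet (A k)) (hd : Pairwise (Function.onFun Disjoint A)) :
    ∃ P : Lp 𝕜 1 m →L[𝕜] lp (fun _ : ℕ => 𝕜) 1, (∀ f, ‖P f‖ ≤ ‖f‖) ∧
      ∀ B, MeasurableSet B → ∀ k,
        P (indicatorVectorMeasure 𝕜 m B) k = (m.real (B ∩ A k) : 𝕜) := by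
  have hsum : ∀ (f : Lp 𝕜 1 m) (s : Finset ℕ), ∑ k ∈ s, ‖∫ x in A k, f x ∂m‖ ≤ ‖f‖ := by
    intro f s
    have hf : Integrable f m := L1.integrable_coeFn f
    calc ∑ k ∈ s, ‖∫ x in A k, f x ∂m‖ ≤ ∑ k ∈ s, ∫ x in A k, ‖f x‖ ∂m :=
          Finset.sum_le_sum fun k _ => norm_integral_le_integral_norm _
      _ = ∫ x in ⋃ k ∈ s, A k, ‖f x‖ ∂m :=
          (integral_biUnion_finset s (fun k _ => hA k) (fun i _ j _ hij => hd hij)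
            fun k _ => hf.norm.integrableOn).symm
      _ ≤ ∫ x, ‖f x‖ ∂m :=
          setIntegral_le_integral hf.norm (.of_forall fun x => norm_nonneg _)
      _ = ‖f‖ := (L1.norm_eq_integral_norm f).symm
  have hmem : ∀ f : Lp 𝕜 1 m, Memℓp (fun k => ∫ x in A k, f x ∂m) 1 := fun f =>
    memℓp_gen' (C := ‖f‖) fun s => by simpa using hsum f s
  have hn : ∀ f : Lp 𝕜 1 m, ‖(⟨_, hmem f⟩ : lp (fun _ : ℕ => 𝕜) 1)‖ ≤ ‖f‖ := fun f =>
    lp.norm_le_of_forall_sum_le (by simp) (norm_nonneg _) fun s => by simpa using hsum f s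
  refine ⟨LinearMap.mkContinuous
    { toFun := fun f => ⟨_, hmem f⟩
      map_add' := fun f g => ?_
      map_smul' := fun c f => ?_ } 1 fun f => by rw [one_mul]; exact hn f, hn, fun B hB k => ?_⟩
  · ext k
    change ∫ x in A k, (f + g) x ∂m = (∫ x in A k, f x ∂m) + ∫ x in A k, g x ∂m
    rw [← integral_add (L1.integrable_coeFn f).integrableOn (L1.integrable_coeFn g).integrableOn]
    exact integral_congr_ae (ae_restrict_of_ae (Lp.coeFn_add f g))
  · ext k
    change ∫ x in A k, (c • f) x ∂m = c • ∫ x in A k, f x ∂m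
    rw [← integral_smul]
    exact integral_congr_ae (ae_restrict_of_ae (Lp.coeFn_smul c f))
  · change ∫ x in A k, indicatorVectorMeasure 𝕜 m B x ∂m = _
    rw [integral_congr_ae (ae_restrict_of_ae (indicatorVectorMeasure_coeFn hB)),
      setIntegral_indicator hB, setIntegral_const, RCLike.real_smul_eq_coe_mul, mul_one,
      Set.inter_comm]

theorem BishopPhelpsBollobasProperty.L1_of_radonNikodymProperty (μ : Measure α)
    {Y : Type v} [NormedAddCommGroup Y]
    [NormedSpace ℝ Y] [NormedSpace 𝕜 Y] [IsScalarTower ℝ 𝕜 Y] [CompleteSpace Y]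
    (hY : RadonNikodymProperty.{u, v} Y)
    (h : BishopPhelpsBollobasProperty 𝕜 (lp (fun _ : ℕ => 𝕜) 1) Y) :
    BishopPhelpsBollobasProperty 𝕜 (Lp 𝕜 1 μ) Y := by
  refine .of_probability μ fun ε hε hε1 => ?_
  -- The transfer lemma loses factors `2` and `3`, both absorbed by `ε / 4`.
  obtain ⟨η, hη, h⟩ := h (ε / 4) (by positivity) (by linarith)
  refine ⟨min η (ε / 4), by positivity, fun m _ T hT hT1 => ?_⟩
  rw [← indicatorVectorMeasure_apply] at hT1 ⊢
  set χ := indicatorVectorMeasure 𝕜 m with hχ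
  -- The error `ε / 8` is spent twice: comparing `T` with `y k` on `B ∩ A k`, and again on the whole
  -- of `A k`.
  obtain ⟨A, y, hA, hd, hU, hAy⟩ := hY.exists_partition m hT (show 0 < ε / 8 by positivity)
  rw [← hχ] at hAy
  obtain ⟨P, hP, hPχ⟩ := exists_L1_to_lp_one (𝕜 := 𝕜) m hA hd
  rw [← hχ] at hPχ
  have hχn : ∀ B, MeasurableSet B → ‖χ B‖ = m.real B := fun B hB => norm_indicatorVectorMeasure hB
  -- For null pieces `0⁻¹ = 0` gives `u k = 0`. Hence `P ∘ J` is not the identity but the coordinate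
  -- projection onto the non-null pieces, and `J ∘ P` is the averaging operator.
  let u : ℕ → Lp 𝕜 1 m := fun k => (m.real (A k) : 𝕜)⁻¹ • χ (A k)
  have hu_zero : ∀ k, m.real (A k) = 0 → u k = 0 := fun k hk => by simp [u, hk]
  have hχ_zero : ∀ B, MeasurableSet B → m.real B = 0 → χ B = 0 := fun B hB hB0 => by
    rw [← norm_eq_zero, hχn B hB, hB0]
  have hun : ∀ k, ‖u k‖ ≤ 1 := fun k => by
    rw [norm_smul, hχn _ (hA k), norm_inv, RCLike.norm_ofReal, abs_of_nonneg measureReal_nonneg]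
    exact inv_mul_le_one
  obtain ⟨J, hJ, hJn⟩ := exists_lp_one_lift (𝕜 := 𝕜) hun
  have hPJ : ∀ z k, P (J z) k = if m.real (A k) = 0 then 0 else z k := by
    intro z k
    let e : Lp 𝕜 1 m →L[𝕜] 𝕜 := (lp.evalCLM 𝕜 (fun _ : ℕ => 𝕜) 1 k).comp P
    have h1 : HasSum (fun j => z j • e (u j)) (P (J z) k) := by
      have := (hJ z).mapL e
      simp only [map_smul] at this
      exact this
    have h2 : ∀ j, e (u j) = (m.real (A j) : 𝕜)⁻¹ * (m.real (A j ∩ A k) : 𝕜) := fun j => by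
      change P (u j) k = _
      simp only [u, map_smul]
      rw [lp.coeFn_smul, Pi.smul_apply, hPχ _ (hA j), smul_eq_mul]
    have h3 := hasSum_single (f := fun j => z j • e (u j)) k fun j hj => by
      rw [h2, (hd hj).inter_eq]
      simp
    rw [h1.unique h3, h2, Set.inter_self]
    split_ifs with h0
    · simp [h0]
    · rw [inv_mul_cancel₀ (by exact_mod_cast h0), smul_eq_mul, mul_one]
  have hsplit : ∀ z, ‖z - P (J z)‖ + ‖P (J z)‖ ≤ ‖z‖ := fun z => by
    refine ((lp_one_hasSum_norm _).add (lp_one_hasSum_norm _)).unique ?_ |>.le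
    refine (lp_one_hasSum_norm z).congr_fun fun k => ?_
    rw [lp.coeFn_sub, Pi.sub_apply, hPJ]
    split_ifs <;> simp
  have hJPJ : ∀ z, J (P (J z)) = J z := fun z => by
    refine (hJ _).unique ((hJ z).congr_fun fun k => ?_)
    rw [hPJ]
    split_ifs with h0
    · simp [hu_zero k h0]
    · rfl
  have hsumχ : ∀ B, MeasurableSet B → HasSum (fun k => χ (B ∩ A k)) (χ B) := fun B hB => by
    have := χ.m_iUnion (fun k => hB.inter (hA k)) fun i j hij =>
      (hd hij).mono Set.inter_subset_right Set.inter_subset_right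
    rwa [← Set.inter_iUnion, hU, Set.inter_univ] at this
  have hJP : J (P (χ Set.univ)) = χ Set.univ := by
    refine (hJ _).unique ((hsumχ _ MeasurableSet.univ).congr_fun fun k => ?_)
    rw [hPχ _ MeasurableSet.univ, Set.univ_inter]
    by_cases h0 : m.real (A k) = 0
    · simp [h0, hχ_zero _ (hA k) h0]
    · exact smul_inv_smul₀ (by exact_mod_cast h0) _
  have hfar : ‖T - T.comp (J.comp P)‖ ≤ ε / 4 := by
    refine opNorm_le_of_indicatorVectorMeasure (by positivity) fun B hB => ?_
    have h1 : HasSum (fun k => T (χ (B ∩ A k)) - (m.real (B ∩ A k) : 𝕜) • T (u k))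
        ((T - T.comp (J.comp P)) (χ B)) := by
      refine ((hsumχ B hB).mapL T).sub ?_
      have := (hJ (P (χ B))).mapL T
      simp only [map_smul, hPχ B hB] at this
      exact this
    have h2 : HasSum (fun k => ε / 4 * m.real (B ∩ A k)) (ε / 4 * m.real B) := by
      refine HasSum.mul_left _ ?_
      have := m.toSignedMeasure.m_iUnion (fun k => hB.inter (hA k)) fun i j hij =>
        (hd hij).mono Set.inter_subset_right Set.inter_subset_right
      rw [← Set.inter_iUnion, hU, Set.inter_univ] at this
      simpa [Measure.toSignedMeasure_apply, hB, hB.inter (hA _)] using this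
    refine h1.norm_le_of_bounded h2 fun k => ?_
    have hBk := hB.inter (hA k)
    by_cases h0 : m.real (A k) = 0
    · have : m.real (B ∩ A k) = 0 :=
        le_antisymm (h0 ▸ measureReal_mono Set.inter_subset_right) measureReal_nonneg
      simp [hχ_zero _ hBk this, this]
    · have ha : 0 < m.real (A k) := lt_of_le_of_ne measureReal_nonneg (Ne.symm h0)
      have hne : (m.real (A k) : 𝕜) ≠ 0 := by exact_mod_cast h0
      have e1 := hAy k _ hBk Set.inter_subset_right
      have e2 := hAy k _ (hA k) subset_rfl
      have e3 : ‖y k - T (u k)‖ ≤ ε / 8 := by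
        have : y k - T (u k) =
            -((m.real (A k) : 𝕜)⁻¹ • (T (χ (A k)) - (m.real (A k) : 𝕜) • y k)) := by
          rw [smul_sub, inv_smul_smul₀ hne, neg_sub, map_smul]
        rw [this, norm_neg, norm_smul, norm_inv, RCLike.norm_ofReal, abs_of_pos ha,
          inv_mul_le_iff₀ ha, mul_comm]
        exact e2
      have e4 : T (χ (B ∩ A k)) - (m.real (B ∩ A k) : 𝕜) • T (u k) =
          (T (χ (B ∩ A k)) - (m.real (B ∩ A k) : 𝕜) • y k) +
            (m.real (B ∩ A k) : 𝕜) • (y k - T (u k)) := by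
        rw [smul_sub]
        abel
      rw [e4]
      refine (norm_add_le _ _).trans ?_
      rw [norm_smul, RCLike.norm_ofReal, abs_of_nonneg measureReal_nonneg]
      have := mul_le_mul_of_nonneg_left e3 (measureReal_nonneg (μ := m) (s := B ∩ A k))
      linarith
  obtain ⟨y₀, S, hy₀, hS, hSy, hyx, hST⟩ := exists_attaining_of_lProjection hP
    (fun z => (congrArg norm (hJPJ z)).symm.le.trans (hJn _)) hsplit
    (by rw [hχn _ MeasurableSet.univ, probReal_univ]) hJP (by linarith) h hT
    (by linarith [min_le_left η (ε / 4)]) (by linarith [min_le_right η (ε / 4)]) hfar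
  exact ⟨y₀, S, hy₀, hS, hSy, by linarith, by linarith⟩

end RadonNikodym

/-! ### Uniform convexity of `L^q`. -/

section LpUniformConvex

variable {E : Type*} [NormedAddCommGroup E]

theorem add_rpow_le_mul_rpow_add_rpow {x y p : ℝ} (hx : 0 ≤ x) (hy : 0 ≤ y) (hp : 1 ≤ p) :
    (x + y) ^ p ≤ 2 ^ (p - 1) * (x ^ p + y ^ p) := by
  lift x to NNReal using hx
  lift y to NNReal using hy
  exact_mod_cast NNReal.rpow_add_le_mul_rpow_add_rpow x y hp

theorem norm_add_rpow_le (a b : E) {p : ℝ} (hp : 1 ≤ p) :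
    ‖a + b‖ ^ p ≤ 2 ^ (p - 1) * (‖a‖ ^ p + ‖b‖ ^ p) :=
  (Real.rpow_le_rpow (norm_nonneg _) (norm_add_le a b) (by linarith)).trans
    (add_rpow_le_mul_rpow_add_rpow (norm_nonneg a) (norm_nonneg b) hp)

theorem Lp_norm_rpow_eq_integral {β : Type*} [MeasurableSpace β] {ν : Measure β} {q : ℝ≥0∞}
    (hq : q ≠ 0) (hq' : q ≠ ∞) (f : Lp E q ν) :
    ‖f‖ ^ q.toReal = ∫ x, ‖f x‖ ^ q.toReal ∂ν := by
  have h0 : 0 < q.toReal := ENNReal.toReal_pos hq hq'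
  have hi : 0 ≤ ∫ x, ‖f x‖ ^ q.toReal ∂ν := integral_nonneg fun x => by positivity
  rw [Lp.norm_def, (Lp.memLp f).eLpNorm_eq_integral_rpow_norm hq hq',
    ENNReal.toReal_ofReal (by positivity), ← Real.rpow_mul hi, inv_mul_cancel₀ h0.ne',
    Real.rpow_one]

variable [NormedSpace ℝ E]

/-- For equal norms strictness comes from the strictly convex norm, otherwise from strict convexity
of `t ↦ t ^ p`. -/
theorem norm_add_rpow_lt [StrictConvexSpace ℝ E] {a b : E} (hab : a ≠ b) {p : ℝ} (hp : 1 < p) :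
    ‖a + b‖ ^ p < 2 ^ (p - 1) * (‖a‖ ^ p + ‖b‖ ^ p) := by
  have hp0 : 0 < p := by linarith
  by_cases h : ‖a‖ = ‖b‖
  · have h1 : ‖a + b‖ < ‖a‖ + ‖b‖ := by
      rw [← not_sameRay_iff_norm_add_lt, sameRay_iff_of_norm_eq h]
      exact hab
    exact (Real.rpow_lt_rpow (norm_nonneg _) h1 hp0).trans_le
      (add_rpow_le_mul_rpow_add_rpow (norm_nonneg a) (norm_nonneg b) hp.le)
  · refine (Real.rpow_le_rpow (norm_nonneg _) (norm_add_le a b) hp0.le).trans_lt ?_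
    have h1 := (strictConvexOn_rpow hp).2 (Set.mem_Ici.2 (norm_nonneg a))
      (Set.mem_Ici.2 (norm_nonneg b)) h (by norm_num : (0 : ℝ) < 1 / 2)
      (by norm_num : (0 : ℝ) < 1 / 2) (by norm_num)
    simp only [smul_eq_mul] at h1
    rw [← mul_add, Real.mul_rpow (by norm_num) (by positivity), ← mul_add,
      Real.div_rpow (by norm_num) (by norm_num), Real.one_rpow] at h1
    have h2 : (2 : ℝ) ^ (p - 1) = 2 ^ p * (1 / 2) := by
      rw [Real.rpow_sub_one (by norm_num)]
      ring
    have h3 : (0 : ℝ) < 2 ^ p := by positivity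
    rw [h2, mul_assoc]
    calc (‖a‖ + ‖b‖) ^ p = 2 ^ p * (1 / 2 ^ p * (‖a‖ + ‖b‖) ^ p) := by field_simp
      _ < _ := mul_lt_mul_of_pos_left h1 h3

/-- A quantitative form of `norm_add_rpow_lt`: both sides are `p`-homogeneous, so the gap need only
be bounded below on a compact set of normalized, separated pairs. Linearity in the `p`-th powers
makes it integrable. -/
theorem exists_norm_add_rpow_le_sub [StrictConvexSpace ℝ E] [ProperSpace E] {p : ℝ} (hp : 1 < p)
    {c : ℝ} (hc : 0 < c) :
    ∃ δ : ℝ, 0 < δ ∧ ∀ a b : E, ‖a + b‖ ^ p ≤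
      2 ^ (p - 1) * (‖a‖ ^ p + ‖b‖ ^ p) - δ * (‖a - b‖ ^ p - c * (‖a‖ ^ p + ‖b‖ ^ p)) := by
  have hp0 : 0 < p := by linarith
  have hcont : Continuous fun t : ℝ => t ^ p := Real.continuous_rpow_const hp0.le
  let K : Set (E × E) := {z | ‖z.1‖ ^ p + ‖z.2‖ ^ p = 1 ∧ c ≤ ‖z.1 - z.2‖ ^ p}
  have hle1 : ∀ t : ℝ, 0 ≤ t → t ^ p ≤ 1 → t ≤ 1 := fun t ht h => by
    by_contra! h1
    exact (Real.one_lt_rpow h1 hp0).not_ge h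
  have hK : IsCompact K := by
    refine Metric.isCompact_of_isClosed_isBounded ?_ ?_
    · refine (isClosed_eq ?_ continuous_const).and (isClosed_le continuous_const ?_)
      · exact (hcont.comp continuous_fst.norm).add (hcont.comp continuous_snd.norm)
      · exact hcont.comp (continuous_fst.sub continuous_snd).norm
    · refine isBounded_iff_forall_norm_le.2 ⟨1, fun z hz => ?_⟩
      have h1 : 0 ≤ ‖z.1‖ ^ p := by positivity
      have h2 : 0 ≤ ‖z.2‖ ^ p := by positivity
      exact max_le (hle1 _ (norm_nonneg _) (by linarith [hz.1]))
        (hle1 _ (norm_nonneg _) (by linarith [hz.1]))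
  have hsub : ∀ a b : E, ‖a - b‖ ^ p ≤ 2 ^ (p - 1) * (‖a‖ ^ p + ‖b‖ ^ p) := fun a b => by
    simpa [sub_eq_add_neg] using norm_add_rpow_le a (-b) hp.le
  obtain ⟨δ, hδ, hδK⟩ : ∃ δ : ℝ, 0 < δ ∧ ∀ z ∈ K,
      ‖z.1 + z.2‖ ^ p ≤ 2 ^ (p - 1) - δ * 2 ^ (p - 1) := by
    have h2 : (0 : ℝ) < 2 ^ (p - 1) := by positivity
    rcases K.eq_empty_or_nonempty with h | h
    · exact ⟨1, one_pos, by simp [h]⟩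
    · obtain ⟨z, hz, hmax⟩ := hK.exists_isMaxOn h (f := fun z => ‖z.1 + z.2‖ ^ p)
        (hcont.comp (continuous_fst.add continuous_snd).norm).continuousOn
      have hne : z.1 ≠ z.2 := fun h => by
        have := hz.2
        rw [h, sub_self, norm_zero, Real.zero_rpow hp0.ne'] at this
        linarith
      have hlt := norm_add_rpow_lt hne hp
      rw [hz.1, mul_one] at hlt
      refine ⟨1 - ‖z.1 + z.2‖ ^ p / 2 ^ (p - 1), sub_pos.2 ((div_lt_one h2).2 hlt),
        fun w hw => (hmax hw).trans_eq ?_⟩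
      field_simp
      ring
  refine ⟨δ, hδ, fun a b => ?_⟩
  set s := ‖a‖ ^ p + ‖b‖ ^ p with hs
  -- For nearby vectors the correction term is nonpositive, so convexity alone suffices.
  by_cases hab : ‖a - b‖ ^ p ≤ c * s
  · have := norm_add_rpow_le a b hp.le
    nlinarith
  rw [not_le] at hab
  have hs0 : 0 < s := by
    refine lt_of_le_of_ne (by positivity) fun h => ?_
    have := hsub a b
    rw [← hs, ← h] at this
    rw [← h] at hab
    linarith
  set t : ℝ := s ^ (-p⁻¹) with ht
  have ht0 : 0 < t := Real.rpow_pos_of_pos hs0 _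
  have htp : t ^ p = s⁻¹ := by
    rw [ht, ← Real.rpow_mul hs0.le, neg_mul, inv_mul_cancel₀ hp0.ne', Real.rpow_neg_one]
  have hsc : ∀ x : E, ‖t • x‖ ^ p = s⁻¹ * ‖x‖ ^ p := fun x => by
    rw [norm_smul, Real.norm_of_nonneg ht0.le, Real.mul_rpow ht0.le (norm_nonneg _), htp]
  have hmem : (t • a, t • b) ∈ K := by
    refine ⟨?_, ?_⟩
    · simp only [hsc]
      rw [← mul_add, ← hs, inv_mul_cancel₀ hs0.ne']
    · simp only [← smul_sub, hsc]
      rw [le_inv_mul_iff₀ hs0, mul_comm]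
      exact hab.le
  have h1 := hδK _ hmem
  simp only [← smul_add, hsc] at h1
  rw [inv_mul_le_iff₀ hs0] at h1
  have h2 := hsub a b
  have h3 : δ * (‖a - b‖ ^ p - c * s) ≤ δ * (2 ^ (p - 1) * s) :=
    mul_le_mul_of_nonneg_left (by nlinarith [mul_pos hc hs0]) hδ.le
  linarith

theorem uniformConvexSpace_Lp [StrictConvexSpace ℝ E] [ProperSpace E] {β : Type*}
    [MeasurableSpace β] (ν : Measure β) {q : ℝ≥0∞} [Fact (1 ≤ q)] (hq : 1 < q) (hq' : q < ∞) :
    UniformConvexSpace (Lp E q ν) := by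
  have hq0 : q ≠ 0 := (zero_lt_one.trans hq).ne'
  set p := q.toReal with hp_def
  have hp : 1 < p := by
    have := (ENNReal.toReal_lt_toReal ENNReal.one_ne_top hq'.ne).2 hq
    simpa using this
  have hp0 : 0 < p := by linarith
  refine ⟨fun ε hε => ?_⟩
  have hεp : 0 < ε ^ p := by positivity
  -- On unit vectors `‖f‖ ^ p + ‖g‖ ^ p` integrates to `2`, so this `c` uses up half of the
  -- separation `ε ^ p`.
  obtain ⟨δ, hδ, h⟩ := exists_norm_add_rpow_le_sub (E := E) hp (c := ε ^ p / 4) (by positivity)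
  -- The `max` keeps the base nonnegative when taking the `p`-th root.
  have hlt : (max 0 (2 ^ p - δ * (ε ^ p / 2))) ^ p⁻¹ < 2 := by
    have h1 : max 0 ((2 : ℝ) ^ p - δ * (ε ^ p / 2)) < 2 ^ p :=
      max_lt (by positivity) (by linarith [mul_pos hδ (half_pos hεp)])
    have h2 := Real.rpow_lt_rpow (le_max_left _ _) h1 (inv_pos.2 hp0)
    rwa [← Real.rpow_mul (by norm_num), mul_inv_cancel₀ hp0.ne', Real.rpow_one] at h2
  refine ⟨2 - (max 0 (2 ^ p - δ * (ε ^ p / 2))) ^ p⁻¹, sub_pos.2 hlt, fun f hf g hg hfg => ?_⟩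
  rw [sub_sub_cancel]
  have hI : ∀ u : Lp E q ν, Integrable (fun x => ‖u x‖ ^ p) ν := fun u =>
    (Lp.memLp u).integrable_norm_rpow hq0 hq'.ne
  have hN := Lp_norm_rpow_eq_integral (E := E) (ν := ν) hq0 hq'.ne
  rw [← hp_def] at hN
  have hd : Integrable (fun x => ‖(f - g) x‖ ^ p - ε ^ p / 4 * (‖f x‖ ^ p + ‖g x‖ ^ p)) ν :=
    (hI _).sub (((hI f).add (hI g)).const_mul _)
  have hs : Integrable (fun x => ‖f x‖ ^ p + ‖g x‖ ^ p) ν := (hI f).add (hI g)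
  have hsi : ∫ x, (‖f x‖ ^ p + ‖g x‖ ^ p) ∂ν = 2 := by
    rw [integral_add (hI f) (hI g), ← hN, ← hN, hf, hg, Real.one_rpow]
    norm_num
  have h1 : ‖f + g‖ ^ p ≤ 2 ^ p - δ * (‖f - g‖ ^ p - ε ^ p / 2) := by
    have h2 : ∫ x, ‖(f + g) x‖ ^ p ∂ν ≤ ∫ x, (2 ^ (p - 1) * (‖f x‖ ^ p + ‖g x‖ ^ p) -
        δ * (‖(f - g) x‖ ^ p - ε ^ p / 4 * (‖f x‖ ^ p + ‖g x‖ ^ p))) ∂ν := by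
      refine integral_mono_ae (hI _)
        ((hs.const_mul _).sub (hd.const_mul _)) ?_
      filter_upwards [Lp.coeFn_add f g, Lp.coeFn_sub f g] with x hx hx'
      rw [hx, hx']
      exact h (f x) (g x)
    rw [integral_sub (hs.const_mul _) (hd.const_mul _),
      integral_const_mul, integral_const_mul, integral_sub (hI _) (hs.const_mul _),
      integral_const_mul, hsi, ← hN, ← hN, Real.rpow_sub_one (by norm_num)] at h2
    linarith
  have h3 : ε ^ p ≤ ‖f - g‖ ^ p := Real.rpow_le_rpow hε.le hfg hp0.le
  have h4 : ‖f + g‖ ^ p ≤ max 0 (2 ^ p - δ * (ε ^ p / 2)) := by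
    refine le_max_of_le_right (h1.trans ?_)
    nlinarith
  have h5 := Real.rpow_le_rpow (by positivity) h4 (inv_nonneg.2 hp0.le)
  rwa [← Real.rpow_mul (norm_nonneg _), mul_inv_cancel₀ hp0.ne', Real.rpow_one] at h5

end LpUniformConvex

theorem corollary2p3 {𝕜 : Type*} [RCLike 𝕜] {α : Type u} [MeasurableSpace α] (μ : Measure α) :
    (∀ (Y : Type v) [NormedAddCommGroup Y] [NormedSpace ℝ Y] [NormedSpace 𝕜 Y]
        [IsScalarTower ℝ 𝕜 Y] [CompleteSpace Y],
      RadonNikodymProperty.{u, v} Y →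
      BishopPhelpsBollobasProperty 𝕜 (lp (fun _ : ℕ => 𝕜) 1) Y →
      BishopPhelpsBollobasProperty 𝕜 (Lp 𝕜 1 μ) Y) ∧
    (∀ (β : Type w) [MeasurableSpace β] (ν : Measure β) (q : ℝ≥0∞) [Fact (1 ≤ q)],
      1 < q → q < ∞ →
      BishopPhelpsBollobasProperty 𝕜 (Lp 𝕜 1 μ) (Lp 𝕜 q ν)) := by
  refine ⟨fun Y _ _ _ _ _ hY h => .L1_of_radonNikodymProperty μ hY h, fun β _ ν q _ hq hq' => ?_⟩
  have := uniformConvexSpace_Lp (E := 𝕜) ν hq hq'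
  exact .L1_of_uniformConvexSpace μ _
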